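/- Let $\mathbb K$ be a field of characteristic $0$, and let $\Lambda$ be the $\mathbb K$-algebra of symmetric functions, i.e. of power series of bounded degree over $\mathbb K$ in $x_1,x_2,\dots$ that are invariant under all permutations of the variables. For a partition $\lambda=(\lambda_1,\dots,\lambda_\ell)$ let $p_\lambda=\prod_{i=1}^{\ell}\bigl(\sum_{j\ge 1}x_j^{\lambda_i}\bigr)$ be the power sum symmetric function, let $m_\lambda$ be the monomial symmetric function (the sum of all distinct monomials whose nonzero exponents are, in some order, the parts of $\lambda$), and let $\widetilde m_\lambda=\bigl(\prod_{i\ge1}r_i(\lambda)!\bigr)\,m_\lambda$, where $r_i(\lambda)$ is the number of parts of $\lambda$ equal to $i$. The $p_\lambda$ and the $\widetilde m_\lambda$ are bases of $\Lambda$. Give $\Lambda$ its standard Hopf algebra structure: the coproduct $\Delta$ is the algebra homomorphism with $\Delta p_n=p_n\otimes 1+1\otimes p_n$, the counit $\varepsilon$ is the constant term, and the antipode is the algebra homomorphism with $p_n\mapsto -p_n$. Grade $\Lambda$ by degree. Let $\widetilde\Lambda$ be the algebra with the same underlying vector space as $\Lambda$ and with the bilinear multiplication $\odot$ given by $\widetilde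 m_\lambda\odot\widetilde m_\mu=\widetilde m_{\lambda\sqcup\mu}$, where $\lambda\sqcup\mu$ is the partition whose parts are all parts of $\lambda$ together with all parts of $\mu$. Then $\widetilde\Lambda$, with the same coproduct, counit and grading as $\Lambda$, is a graded Hopf algebra, whose antipode is the algebra homomorphism $\widetilde\Lambda\to\widetilde\Lambda$ with $\widetilde m_n\mapsto-\widetilde m_n$ for all $n\ge1$. Moreover, the linear map $\Lambda\to\widetilde\Lambda$ with $p_\lambda\mapsto\widetilde m_\lambda$ for all partitions $\lambda$ is an isomorphism of graded Hopf algebras. -/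

import Mathlib

open scoped TensorProduct

noncomputable section

namespace SymmFun

/-- Partitions, as finite multisets of positive integers.
The union `λ ⊔ μ` of two partitions is the sum `lam + mu` of multisets. -/
abbrev Ptn := Multiset ℕ+

/-- The partition formed by the nonzero exponents of the monomial `x ^ d`. -/
def typ (d : ℕ →₀ ℕ) : Ptn := d.support.val.map fun i => (d i).toPNat'

/-- The algebra of symmetric functions over `K`, in the variables `x 0, x 1, …`: formal power series
of bounded degree which are invariant under every permutation of the variables. -/
def symmFun (K : Type*) [Field K] : Subalgebra K (MvPowerSeries ℕ K) where
  carrier := {f | (∀ σ : Equiv.Perm ℕ, MvPowerSeries.renameEquiv K σ f = f) ∧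
    ∃ N : ℕ, ∀ d : ℕ →₀ ℕ, MvPowerSeries.coeff d f ≠ 0 → d.degree ≤ N}
  mul_mem' := by
    rintro f g ⟨hf, N, hN⟩ ⟨hg, M, hM⟩
    refine ⟨fun σ => by rw [map_mul, hf, hg], N + M, fun d hd => ?_⟩
    classical
    rw [MvPowerSeries.coeff_mul] at hd
    obtain ⟨p, hp, hpd⟩ := Finset.exists_ne_zero_of_sum_ne_zero hd
    rw [Finset.HasAntidiagonal.mem_antidiagonal] at hp
    rw [← hp, map_add]
    exact add_le_add (hN _ (left_ne_zero_of_mul hpd)) (hM _ (right_ne_zero_of_mul hpd))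
  add_mem' := by
    rintro f g ⟨hf, N, hN⟩ ⟨hg, M, hM⟩
    refine ⟨fun σ => by rw [map_add, hf, hg], max N M, fun d hd => ?_⟩
    rw [map_add] at hd
    by_cases h : MvPowerSeries.coeff d f = 0
    · exact le_max_of_le_right (hM d fun h' => hd (by rw [h, h', add_zero]))
    · exact le_max_of_le_left (hN d h)
  algebraMap_mem' := by
    intro r
    refine ⟨fun σ => AlgEquiv.commutes _ r, 0, fun d hd => ?_⟩
    classical
    rw [MvPowerSeries.algebraMap_apply, MvPowerSeries.coeff_C] at hd
    have : d = 0 := by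
      by_contra h
      exact hd (if_neg h)
    simp [this]

/-- The ring `Λ` of symmetric functions over `K`. -/
def Sym (K : Type*) [Field K] : Type _ := symmFun K

instance (K : Type*) [Field K] : CommRing (Sym K) := inferInstanceAs (CommRing (symmFun K))

instance (K : Type*) [Field K] : Algebra K (Sym K) := inferInstanceAs (Algebra K (symmFun K))

variable {K : Type*} [Field K]

/-- The underlying power series of a symmetric function. -/
def toSeries (K : Type*) [Field K] : Sym K →ₐ[K] MvPowerSeries ℕ K := (symmFun K).val

/-- The coefficient of the monomial `x ^ d`. -/
def cf (d : ℕ →₀ ℕ) : Sym K →ₗ[K] K := (MvPowerSeries.coeff d).comp (toSeries K).toLinearMap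

theorem cf_ext {f g : Sym K} (h : ∀ d, cf d f = cf d g) : f = g :=
  Subtype.ext (MvPowerSeries.ext h)

theorem coeff_perm (σ : Equiv.Perm ℕ) (f : MvPowerSeries ℕ K) (d : ℕ →₀ ℕ) :
    MvPowerSeries.coeff (d.embDomain σ.toEmbedding) (MvPowerSeries.renameEquiv K σ f) =
      MvPowerSeries.coeff d f :=
  MvPowerSeries.coeff_embDomain_rename σ.toEmbedding f d

theorem count_typ (d : ℕ →₀ ℕ) (n : ℕ+) :
    (typ d).count n = (d.support.filter fun i => d i = n).card := by
  rw [typ, Multiset.count_map, Finset.card_def, Finset.filter_val]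
  congr 1
  refine Multiset.filter_congr fun i hi => ?_
  have hi : 0 < d i := Nat.pos_of_ne_zero (Finsupp.mem_support_iff.1 hi)
  rw [← PNat.coe_inj, Nat.toPNat'_coe, if_pos hi, eq_comm]

theorem card_typ (d : ℕ →₀ ℕ) : (typ d).card = d.support.card := by simp [typ]

theorem exists_perm {d e : ℕ →₀ ℕ} (h : typ d = typ e) :
    ∃ σ : Equiv.Perm ℕ, d.embDomain σ.toEmbedding = e := by
  have key : ∀ v : ℕ, Nonempty ({i // d i = v} ≃ {i // e i = v}) := by
    intro v
    rcases Nat.eq_zero_or_pos v with rfl | hv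
    · have inf : ∀ c : ℕ →₀ ℕ, Infinite {i // c i = 0} := fun c => by
        have : {i | c i = 0} = (c.support : Set ℕ)ᶜ := by ext; simp
        have h2 : {i | c i = 0}.Infinite := this ▸ c.support.finite_toSet.infinite_compl
        exact Set.infinite_coe_iff.2 h2
      have := inf d
      have := inf e
      exact nonempty_equiv_of_countable
    · obtain ⟨n, rfl⟩ : ∃ n : ℕ+, (n : ℕ) = v := ⟨⟨v, hv⟩, rfl⟩
      have fib : ∀ c : ℕ →₀ ℕ, Nonempty ({i // c i = n} ≃ Fin ((typ c).count n)) := fun c => by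
        rw [count_typ]
        have : ∀ i, c i = n ↔ i ∈ c.support.filter fun i => c i = n := by
          intro i
          simp only [Finset.mem_filter, Finsupp.mem_support_iff]
          omega
        exact ⟨(Equiv.subtypeEquivRight this).trans (Finset.equivFin _)⟩
      obtain ⟨a⟩ := fib d
      obtain ⟨b⟩ := fib e
      exact ⟨a.trans ((finCongr (by rw [h])).trans b.symm)⟩
  let σ : Equiv.Perm ℕ := Equiv.ofFiberEquiv fun v => (key v).some
  refine ⟨σ, ?_⟩
  ext i
  obtain ⟨j, rfl⟩ := σ.surjective i
  have := Equiv.ofFiberEquiv_map (fun v => (key v).some) j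
  exact (Finsupp.embDomain_apply_self σ.toEmbedding d j).trans this.symm

theorem typ_embDomain (d : ℕ →₀ ℕ) (σ : ℕ ↪ ℕ) : typ (d.embDomain σ) = typ d := by
  simp [typ, Finsupp.support_embDomain, Multiset.map_map, Finsupp.embDomain_apply_self]

theorem cf_eq_of_typ_eq (f : Sym K) {d e : ℕ →₀ ℕ} (h : typ d = typ e) : cf d f = cf e f := by
  obtain ⟨σ, rfl⟩ := exists_perm h
  have := coeff_perm σ (toSeries K f) d
  rw [show MvPowerSeries.renameEquiv K σ (toSeries K f) = toSeries K f from f.2.1 σ] at this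
  exact this.symm

theorem sum_typ (d : ℕ →₀ ℕ) : ((typ d).map fun n : ℕ+ => (n : ℕ)).sum = d.degree := by
  rw [typ, Multiset.map_map, Finsupp.degree_apply]
  refine congrArg Multiset.sum (Multiset.map_congr rfl fun i hi => ?_)
  have hi : 0 < d i := Nat.pos_of_ne_zero (Finsupp.mem_support_iff.1 hi)
  simp [Nat.toPNat'_coe, hi]

/-- The sum of all distinct monomials whose nonzero exponents are, in some order, the parts
of `λ`. -/
def monoSeries (K : Type*) [Field K] (lam : Ptn) : MvPowerSeries ℕ K :=
  fun d => if typ d = lam then 1 else 0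

theorem coeff_monoSeries (lam : Ptn) (d : ℕ →₀ ℕ) :
    MvPowerSeries.coeff d (monoSeries K lam) = if typ d = lam then 1 else 0 := rfl

/-- The monomial symmetric function `m_λ`. -/
def mono (K : Type*) [Field K] (lam : Ptn) : Sym K :=
  ⟨monoSeries K lam, by
    refine ⟨fun σ => ?_, (lam.map fun n : ℕ+ => (n : ℕ)).sum, fun d hd => ?_⟩
    · ext d
      obtain ⟨e, rfl⟩ : ∃ e : ℕ →₀ ℕ, e.embDomain σ.toEmbedding = d :=
        ⟨d.embDomain σ.symm.toEmbedding, by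
          rw [Finsupp.embDomain_eq_mapDomain, Finsupp.embDomain_eq_mapDomain,
            ← Finsupp.mapDomain_comp]
          simp⟩
      rw [coeff_perm]
      simp only [coeff_monoSeries, typ_embDomain]
    · have : typ d = lam := by
        by_contra h
        exact hd (if_neg h)
      rw [← this, sum_typ]⟩

theorem cf_mono (lam : Ptn) (d : ℕ →₀ ℕ) : cf d (mono K lam) = if typ d = lam then 1 else 0 := rfl

/-- The number `∏ i, r_i(λ)!`, where `r_i(λ)` is the number of parts of `λ` equal to `i`. -/
def zee (lam : Ptn) : ℕ := ∏ i ∈ lam.toFinset, (lam.count i).factorial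

/-- The augmented monomial symmetric function `m̃_λ`. -/
def augMono (K : Type*) [Field K] (lam : Ptn) : Sym K := zee lam • mono K lam

theorem cf_augMono (lam : Ptn) (d : ℕ →₀ ℕ) :
    cf d (augMono K lam) = if typ d = lam then (zee lam : K) else 0 := by
  rw [augMono, map_nsmul, cf_mono]
  split_ifs <;> simp

theorem typ_eq_singleton (d : ℕ →₀ ℕ) (n : ℕ+) :
    typ d = {n} ↔ ∃ i, d = Finsupp.single i (n : ℕ) := by
  constructor
  · intro h
    have h1 : d.support.card = 1 := by rw [← card_typ, h]; rfl
    obtain ⟨i, hi⟩ := Finset.card_eq_one.1 h1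
    refine ⟨i, ?_⟩
    have h2 := sum_typ d
    rw [h, Finsupp.degree_apply, hi] at h2
    rw [(Finsupp.support_eq_singleton.1 hi).2]
    simp at h2
    rw [h2]
  · rintro ⟨i, rfl⟩
    simp [typ]

open Classical in
/-- The power series `x_0 ^ n + x_1 ^ n + ⋯`. -/
def powSumSeries (K : Type*) [Field K] (n : ℕ+) : MvPowerSeries ℕ K :=
  fun d => if ∃ i, d = Finsupp.single i (n : ℕ) then 1 else 0

open Classical in
theorem powSumSeries_eq (n : ℕ+) : powSumSeries K n = monoSeries K {n} := by
  funext d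
  rw [powSumSeries, monoSeries]
  exact if_congr (typ_eq_singleton d n).symm rfl rfl

/-- The power sum `p_n`. -/
def powSum (K : Type*) [Field K] (n : ℕ+) : Sym K :=
  ⟨powSumSeries K n, by rw [powSumSeries_eq]; exact (mono K {n}).2⟩

/-- The power sum symmetric function `p_λ`. -/
def powSumPtn (K : Type*) [Field K] (lam : Ptn) : Sym K := (lam.map (powSum K)).prod

/-! ### The basis of augmented monomial symmetric functions -/

theorem exists_typ (lam : Ptn) : ∃ d, typ d = lam := by
  induction lam using Multiset.induction with
  | empty => exact ⟨0, by simp [typ]⟩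
  | cons n lam ih =>
    obtain ⟨d, rfl⟩ := ih
    obtain ⟨i, hi⟩ := Infinite.exists_notMem_finset d.support
    have hn : (n : ℕ) ≠ 0 := n.ne_zero
    have hdi : d i = 0 := by simpa using hi
    refine ⟨d + Finsupp.single i (n : ℕ), ?_⟩
    have hs : (d + Finsupp.single i (n : ℕ)).support = Finset.cons i d.support hi := by
      ext j
      by_cases hj : j = i
      · subst hj; simp [hn]
      · simp [hj]
    rw [typ, hs, Finset.cons_val, Multiset.map_cons, typ]
    congr 1
    · simp [hdi]
    · refine Multiset.map_congr rfl fun j hj => ?_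
      have : j ≠ i := fun h => hi (h ▸ hj)
      simp [this.symm]

theorem zee_pos (lam : Ptn) : 0 < zee lam := Finset.prod_pos fun _ _ => Nat.factorial_pos _

theorem zee_cons (n : ℕ+) (lam : Ptn) : zee (n ::ₘ lam) = (lam.count n + 1) * zee lam := by
  have h : ∀ m : Ptn, m.toFinset ⊆ insert n lam.toFinset →
      zee m = ∏ i ∈ insert n lam.toFinset, (m.count i).factorial := fun m hm => by
    refine Finset.prod_subset hm fun i _ hi => ?_
    rw [Multiset.count_eq_zero_of_notMem (by simpa using hi), Nat.factorial_zero]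
  rw [h _ (by simp), h lam (Finset.subset_insert _ _), ← Finset.mul_prod_erase _ _
    (Finset.mem_insert_self n _), ← Finset.mul_prod_erase _ (fun i => (lam.count i).factorial)
    (Finset.mem_insert_self n _), Multiset.count_cons_self, Nat.factorial_succ, mul_assoc]
  congr 2
  refine Finset.prod_congr rfl fun i hi => ?_
  rw [Multiset.count_cons_of_ne (Finset.ne_of_mem_erase hi)]

theorem card_support_le (d : ℕ →₀ ℕ) : d.support.card ≤ d.degree := by
  rw [Finsupp.degree_apply, Finset.card_eq_sum_ones]
  exact Finset.sum_le_sum fun i hi => Nat.pos_of_ne_zero (Finsupp.mem_support_iff.1 hi)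

theorem finite_typ (f : Sym K) : {lam : Ptn | ∃ d, typ d = lam ∧ cf d f ≠ 0}.Finite := by
  obtain ⟨N, hN⟩ := f.2.2
  let B : Ptn := (Multiset.range N).bind fun i => Multiset.replicate N i.succPNat
  refine (Set.finite_Iic B).subset ?_
  rintro lam ⟨d, rfl, hd⟩
  have hdeg := hN d hd
  refine Multiset.le_iff_count.2 fun n => ?_
  by_cases hn : n ∈ typ d
  · have h1 : (typ d).count n ≤ N := by
      refine (Multiset.count_le_card _ _).trans ?_
      rw [card_typ]
      exact (card_support_le d).trans hdeg
    have h2 : (n : ℕ) ≤ N := by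
      refine le_trans ?_ hdeg
      rw [← sum_typ]
      exact Multiset.single_le_sum (by simp) _ (Multiset.mem_map_of_mem _ hn)
    refine h1.trans ?_
    rw [Multiset.le_count_iff_replicate_le]
    have h3 : n.natPred ∈ Multiset.range N := by
      rw [Multiset.mem_range, PNat.natPred]
      have := n.pos
      omega
    have h4 := Multiset.le_bind (f := fun i => Multiset.replicate N i.succPNat) _ h3
    rwa [PNat.succPNat_natPred] at h4
  · rw [Multiset.count_eq_zero_of_notMem hn]
    exact Nat.zero_le _

theorem cf_sum (c : Ptn →₀ K) (d : ℕ →₀ ℕ) :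
    cf d (Finsupp.linearCombination K (augMono K) c) = c (typ d) * zee (typ d) := by
  rw [Finsupp.linearCombination_apply, Finsupp.sum, map_sum]
  simp only [map_smul, cf_augMono, smul_eq_mul]
  rw [Finset.sum_eq_single (typ d)]
  · simp
  · intro lam _ h
    rw [if_neg (Ne.symm h), mul_zero]
  · intro h
    rw [Finsupp.notMem_support_iff.1 h, zero_mul]

/-- The augmented monomial symmetric functions `m̃_λ` form a basis of `Λ`. -/
def augMonoBasis (K : Type*) [Field K] [CharZero K] : Module.Basis Ptn K (Sym K) :=
  Module.Basis.mk (v := augMono K)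
    (by
      refine fun c e h => ?_
      ext lam
      obtain ⟨d, rfl⟩ := exists_typ lam
      have hz : (zee (typ d) : K) ≠ 0 := Nat.cast_ne_zero.2 (zee_pos _).ne'
      have := congrArg (cf d) h
      rw [cf_sum, cf_sum] at this
      exact mul_right_cancel₀ hz this)
    (by
      intro f _
      choose ex hex using exists_typ
      let c : Ptn →₀ K := Finsupp.onFinset (finite_typ f).toFinset
        (fun lam => cf (ex lam) f / zee lam) (fun lam h => by
          rw [Set.Finite.mem_toFinset]
          exact ⟨ex lam, hex lam, fun h0 => h (by rw [h0, zero_div])⟩)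
      have : f = Finsupp.linearCombination K (augMono K) c := by
        refine cf_ext fun d => ?_
        have hz : (zee (typ d) : K) ≠ 0 := Nat.cast_ne_zero.2 (zee_pos _).ne'
        rw [cf_sum]
        simp only [c, Finsupp.onFinset_apply]
        rw [div_mul_cancel₀ _ hz]
        exact (cf_eq_of_typ_eq f (hex _)).symm
      rw [this, Finsupp.mem_span_range_iff_exists_finsupp]
      exact ⟨c, (Finsupp.linearCombination_apply K c).symm⟩)

@[simp]
theorem augMonoBasis_apply [CharZero K] (lam : Ptn) : augMonoBasis K lam = augMono K lam :=
  Module.Basis.mk_apply _ _ _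

/-! ### The basis of power sum symmetric functions -/

theorem cf_powSum_mul (n : ℕ+) (f : Sym K) (d : ℕ →₀ ℕ) :
    cf d (powSum K n * f) =
      ∑ i ∈ d.support.filter (fun i => (n : ℕ) ≤ d i), cf (d - Finsupp.single i (n : ℕ)) f := by
  classical
  have h1 : cf d (powSum K n * f) = ∑ p ∈ Finset.HasAntidiagonal.antidiagonal d,
      MvPowerSeries.coeff p.1 (powSumSeries K n) * cf p.2 f := MvPowerSeries.coeff_mul ..
  rw [h1]
  symm
  have hn : (n : ℕ) ≠ 0 := n.ne_zero
  refine Finset.sum_of_injOn (fun i => (Finsupp.single i (n : ℕ), d - Finsupp.single i (n : ℕ)))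
    ?_ ?_ ?_ ?_
  · intro i _ j _ h
    exact (Finsupp.single_left_inj hn).1 (Prod.ext_iff.1 h).1
  · intro i hi
    rw [Finset.mem_coe, Finset.mem_filter] at hi
    rw [Finset.mem_coe, Finset.HasAntidiagonal.mem_antidiagonal]
    exact add_tsub_cancel_of_le (Finsupp.single_le_iff.2 hi.2)
  · rintro ⟨a, b⟩ hab h
    rw [Finset.HasAntidiagonal.mem_antidiagonal] at hab
    refine mul_eq_zero_of_left (if_neg ?_) _
    rintro ⟨i, hi⟩
    dsimp only at hi hab
    subst hi
    subst hab
    refine h ⟨i, ?_, ?_⟩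
    · rw [Finset.mem_coe, Finset.mem_filter, Finsupp.mem_support_iff]
      simp [hn]
    · simp
  · intro i _
    have : MvPowerSeries.coeff (Finsupp.single i (n : ℕ)) (powSumSeries K n) = 1 :=
      if_pos ⟨i, rfl⟩
    rw [this, one_mul]

/-- Symmetric functions involving only monomials in fewer than `k` variables. -/
def fil (K : Type*) [Field K] (k : ℕ) : Submodule K (Sym K) where
  carrier := {f | ∀ d : ℕ →₀ ℕ, k ≤ d.support.card → cf d f = 0}
  add_mem' hf hg d hd := by rw [map_add, hf d hd, hg d hd, add_zero]
  zero_mem' d _ := map_zero _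
  smul_mem' c f hf d hd := by rw [map_smul, hf d hd, smul_zero]

theorem fil_mono {k l : ℕ} (h : k ≤ l) {f : Sym K} (hf : f ∈ fil K k) : f ∈ fil K l :=
  fun d hd => hf d (h.trans hd)

theorem card_support_tsub (d : ℕ →₀ ℕ) (i n : ℕ) :
    d.support.card ≤ (d - Finsupp.single i n).support.card + 1 := by
  classical
  have : d.support ⊆ insert i (d - Finsupp.single i n).support := fun j hj => by
    by_cases h : j = i
    · simp [h]
    · rw [Finset.mem_insert, Finsupp.mem_support_iff, Finsupp.tsub_apply,
        Finsupp.single_eq_of_ne h]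
      exact Or.inr (by simpa using hj)
  exact (Finset.card_le_card this).trans (Finset.card_insert_le _ _)

theorem powSum_mul_mem_fil (n : ℕ+) {k : ℕ} {f : Sym K} (hf : f ∈ fil K k) :
    powSum K n * f ∈ fil K (k + 1) := by
  intro d hd
  rw [cf_powSum_mul]
  refine Finset.sum_eq_zero fun i _ => hf _ ?_
  have := card_support_tsub d i n
  omega

theorem typ_tsub (d : ℕ →₀ ℕ) (i : ℕ) (n : ℕ+) (h : d i = n) :
    typ d = n ::ₘ typ (d - Finsupp.single i (n : ℕ)) := by
  classical
  have hn : (n : ℕ) ≠ 0 := n.ne_zero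
  have hs : d.support = Finset.cons i (d - Finsupp.single i (n : ℕ)).support (by simp [h]) := by
    ext j
    by_cases hj : j = i
    · subst hj; simp [h]
    · simp [hj]
  rw [typ, hs, Finset.cons_val, Multiset.map_cons, typ]
  congr 1
  · simp [h]
  · refine Multiset.map_congr rfl fun j hj => ?_
    have : j ≠ i := by
      rintro rfl
      exact absurd hj (by simp [h])
    simp [Finsupp.single_eq_of_ne this]

theorem typ_tsub_card (d : ℕ →₀ ℕ) (i : ℕ) (n : ℕ) (h : n < d i) :
    (d - Finsupp.single i n).support.card = d.support.card := by
  congr 1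
  ext j
  by_cases hj : j = i
  · subst hj
    simp
    omega
  · simp [Finsupp.single_eq_of_ne hj]

theorem powSum_mul_augMono (n : ℕ+) (lam : Ptn) :
    powSum K n * augMono K lam - augMono K (n ::ₘ lam) ∈ fil K (lam.card + 1) := by
  intro d hd
  rw [map_sub, sub_eq_zero, cf_powSum_mul, cf_augMono]
  simp only [cf_augMono]
  have hdi : ∀ i, typ (d - Finsupp.single i (n : ℕ)) = lam → (n : ℕ) ≤ d i → d i = n := by
    intro i h1 h2
    by_contra h3
    have h4 := typ_tsub_card d i n (by omega)
    rw [← card_typ, h1] at h4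
    omega
  split_ifs with h
  · have hc : ((d.support.filter fun i => d i = n).card : K) * (zee lam : K) =
        (zee (n ::ₘ lam) : K) := by
      rw [← count_typ, h, Multiset.count_cons_self, zee_cons]
      push_cast
      rfl
    rw [← hc, ← nsmul_eq_mul, ← Finset.sum_const]
    symm
    refine Finset.sum_subset_zero_on_sdiff ?_ ?_ ?_
    · intro i hi
      rw [Finset.mem_filter] at hi ⊢
      exact ⟨hi.1, hi.2.ge⟩
    · intro i hi
      rw [Finset.mem_sdiff, Finset.mem_filter, Finset.mem_filter] at hi
      exact if_neg fun h1 => hi.2 ⟨hi.1.1, hdi i h1 hi.1.2⟩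
    · intro i hi
      rw [Finset.mem_filter] at hi
      have := typ_tsub d i n hi.2
      rw [h, Multiset.cons_inj_right] at this
      rw [if_pos this.symm]
  · refine Finset.sum_eq_zero fun i hi => if_neg fun h1 => h ?_
    rw [Finset.mem_filter] at hi
    rw [typ_tsub d i n (hdi i h1 hi.2), h1]

theorem powSumPtn_cons (n : ℕ+) (lam : Ptn) :
    powSumPtn K (n ::ₘ lam) = powSum K n * powSumPtn K lam := by
  simp [powSumPtn]

theorem cf_one (d : ℕ →₀ ℕ) : cf d (1 : Sym K) = if d = 0 then 1 else 0 := by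
  classical
  exact (MvPowerSeries.coeff_one ..).trans (if_congr Iff.rfl rfl rfl)

theorem typ_eq_zero (d : ℕ →₀ ℕ) : typ d = 0 ↔ d = 0 := by
  rw [← Multiset.card_eq_zero, card_typ]
  simp

theorem augMono_zero : augMono K 0 = 1 := by
  refine cf_ext fun d => ?_
  rw [cf_augMono, cf_one]
  refine if_congr (typ_eq_zero d) ?_ rfl
  simp [zee]

theorem powSumPtn_sub_augMono (lam : Ptn) :
    powSumPtn K lam - augMono K lam ∈ fil K lam.card := by
  induction lam using Multiset.induction with
  | empty =>
    have : powSumPtn K 0 - augMono K 0 = 0 := by rw [augMono_zero]; simp [powSumPtn]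
    rw [this]
    exact zero_mem _
  | cons n lam ih =>
    rw [powSumPtn_cons, Multiset.card_cons]
    have := add_mem (powSum_mul_mem_fil n ih) (powSum_mul_augMono (K := K) n lam)
    rwa [mul_sub, sub_add_sub_cancel] at this

/-- The linear endomorphism `m̃_λ ↦ p_λ`. -/
def toPow (K : Type*) [Field K] [CharZero K] : Sym K →ₗ[K] Sym K :=
  (augMonoBasis K).constr K (powSumPtn K)

theorem toPow_augMono [CharZero K] (lam : Ptn) : toPow K (augMono K lam) = powSumPtn K lam := by
  rw [← augMonoBasis_apply, toPow, Module.Basis.constr_basis]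

theorem toPow_sub_mem [CharZero K] {k : ℕ} {f : Sym K} (hf : f ∈ fil K (k + 1)) :
    toPow K f - f ∈ fil K k := by
  obtain ⟨c, rfl⟩ : ∃ c, Finsupp.linearCombination K (augMono K) c = f := by
    have := (augMonoBasis K).linearCombination_repr f
    have h2 : ⇑(augMonoBasis K) = augMono K := funext augMonoBasis_apply
    rw [h2] at this
    exact ⟨_, this⟩
  rw [Finsupp.linearCombination_apply, Finsupp.sum, map_sum, ← Finset.sum_sub_distrib]
  refine Submodule.sum_mem _ fun lam hlam => ?_
  rw [map_smul, toPow_augMono, ← smul_sub]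
  refine Submodule.smul_mem _ _ (fil_mono ?_ (powSumPtn_sub_augMono lam))
  by_contra h
  obtain ⟨d, rfl⟩ := exists_typ lam
  rw [card_typ] at h
  have := hf d (by omega)
  rw [cf_sum] at this
  have hz : (zee (typ d) : K) ≠ 0 := Nat.cast_ne_zero.2 (zee_pos _).ne'
  exact (mul_ne_zero (Finsupp.mem_support_iff.1 hlam) hz) this

theorem exists_mem_fil (f : Sym K) : ∃ k, f ∈ fil K k := by
  obtain ⟨N, hN⟩ := f.2.2
  refine ⟨N + 1, fun d hd => ?_⟩
  by_contra h
  have h1 := hN d h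
  have h2 := card_support_le d
  omega

theorem eq_zero_of_mem_fil {f : Sym K} (hf : f ∈ fil K 0) : f = 0 :=
  cf_ext fun d => by rw [hf d (Nat.zero_le _), map_zero]

theorem toPow_bijective [CharZero K] : Function.Bijective (toPow K) := by
  constructor
  · rw [← LinearMap.ker_eq_bot, LinearMap.ker_eq_bot']
    intro f hf
    obtain ⟨k, hk⟩ := exists_mem_fil f
    induction k with
    | zero => exact eq_zero_of_mem_fil hk
    | succ k ih =>
      refine ih ?_
      have := toPow_sub_mem hk
      rw [hf, zero_sub] at this
      exact neg_mem_iff.1 this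
  · intro f
    obtain ⟨k, hk⟩ := exists_mem_fil f
    induction k generalizing f with
    | zero => exact ⟨0, by rw [eq_zero_of_mem_fil hk, map_zero]⟩
    | succ k ih =>
      obtain ⟨g, hg⟩ := ih _ (toPow_sub_mem hk)
      exact ⟨f - g, by rw [map_sub, hg, sub_sub_cancel]⟩

/-- The power sum symmetric functions `p_λ` form a basis of `Λ`. -/
def powSumBasis (K : Type*) [Field K] [CharZero K] : Module.Basis Ptn K (Sym K) :=
  (augMonoBasis K).map (LinearEquiv.ofBijective (toPow K) toPow_bijective)

@[simp]
theorem powSumBasis_apply [CharZero K] (lam : Ptn) : powSumBasis K lam = powSumPtn K lam := by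
  rw [powSumBasis, Module.Basis.map_apply, augMonoBasis_apply]
  exact toPow_augMono lam

/-- The algebra homomorphism from polynomials sending the `n`-th variable to `p_n`. -/
def polyToSym (K : Type*) [Field K] : MvPolynomial ℕ+ K →ₐ[K] Sym K := MvPolynomial.aeval (powSum K)

theorem polyToSym_bijective [CharZero K] : Function.Bijective (polyToSym K) := by
  let e := (MvPolynomial.basisMonomials ℕ+ K).equiv (powSumBasis K) Multiset.toFinsupp.toEquiv.symm
  have : (polyToSym K).toLinearMap = e.toLinearMap := by
    refine (MvPolynomial.basisMonomials ℕ+ K).ext fun d => ?_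
    rw [LinearEquiv.coe_coe, Module.Basis.equiv_apply, powSumBasis_apply, powSumPtn]
    simp [polyToSym, MvPolynomial.aeval_monomial, Finsupp.toMultiset_map,
      Finsupp.prod_toMultiset, Finsupp.prod_mapDomain_index, pow_add]
  have h2 : ⇑(polyToSym K) = ⇑e := funext fun x => LinearMap.congr_fun this x
  rw [h2]
  exact e.bijective

/-- `Λ` is the polynomial algebra on the power sums `p_1, p_2, …`. -/
def polyEquivSym (K : Type*) [Field K] [CharZero K] : MvPolynomial ℕ+ K ≃ₐ[K] Sym K :=
  AlgEquiv.ofBijective (polyToSym K) polyToSym_bijective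

/-- The algebra homomorphism from `Λ` sending each `p_n` to `a n`. -/
def lift {A : Type*} [CommSemiring A] [Algebra K A] [CharZero K] (a : ℕ+ → A) : Sym K →ₐ[K] A :=
  (MvPolynomial.aeval a).comp (polyEquivSym K).symm.toAlgHom

theorem polyEquivSym_X [CharZero K] (n : ℕ+) :
    polyEquivSym K (MvPolynomial.X n) = powSum K n := by
  change polyToSym K _ = _
  rw [polyToSym, MvPolynomial.aeval_X]

@[simp]
theorem lift_powSum {A : Type*} [CommSemiring A] [Algebra K A] [CharZero K] (a : ℕ+ → A) (n : ℕ+) :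
    lift a (powSum K n) = a n := by
  rw [← polyEquivSym_X]
  simp [lift]

theorem hom_ext {A : Type*} [CommSemiring A] [Algebra K A] [CharZero K] {f g : Sym K →ₐ[K] A}
    (h : ∀ n, f (powSum K n) = g (powSum K n)) : f = g := by
  have : f.comp (polyEquivSym K).toAlgHom = g.comp (polyEquivSym K).toAlgHom := by
    refine MvPolynomial.algHom_ext fun n => ?_
    simpa [polyEquivSym_X] using h n
  ext x
  obtain ⟨y, rfl⟩ := (polyEquivSym K).surjective x
  exact DFunLike.congr_fun this y

/-! ### The Hopf algebra of symmetric functions -/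

/-- The coproduct of `Λ`: the algebra homomorphism with `Δ p_n = p_n ⊗ 1 + 1 ⊗ p_n`. -/
def comulHom (K : Type*) [Field K] [CharZero K] : Sym K →ₐ[K] Sym K ⊗[K] Sym K :=
  lift fun n => powSum K n ⊗ₜ 1 + 1 ⊗ₜ powSum K n

/-- The counit of `Λ`: the constant coefficient. -/
def counitHom (K : Type*) [Field K] : Sym K →ₐ[K] K :=
  { (MvPowerSeries.constantCoeff (σ := ℕ) (R := K)).comp (toSeries K).toRingHom with
    commutes' := fun r => by
      change MvPowerSeries.constantCoeff (algebraMap K (MvPowerSeries ℕ K) r) = r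
      rw [MvPowerSeries.algebraMap_apply, MvPowerSeries.constantCoeff_C]
      rfl }

/-- The antipode of `Λ`: the algebra homomorphism with `S p_n = - p_n`. -/
def antipodeHom (K : Type*) [Field K] [CharZero K] : Sym K →ₐ[K] Sym K :=
  lift fun n => -powSum K n

@[simp]
theorem comulHom_powSum [CharZero K] (n : ℕ+) :
    comulHom K (powSum K n) = powSum K n ⊗ₜ 1 + 1 ⊗ₜ powSum K n := lift_powSum _ n

@[simp]
theorem counitHom_powSum (n : ℕ+) : counitHom K (powSum K n) = 0 := by
  have h : counitHom K (powSum K n) = cf 0 (mono K {n}) := by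
    have : powSum K n = mono K {n} := Subtype.ext (powSumSeries_eq n)
    rw [this, cf, LinearMap.comp_apply, MvPowerSeries.coeff_zero_eq_constantCoeff_apply]
    rfl
  rw [h, cf_mono]
  simp [typ]

@[simp]
theorem antipodeHom_powSum [CharZero K] (n : ℕ+) : antipodeHom K (powSum K n) = -powSum K n :=
  lift_powSum _ n

instance (K : Type*) [Field K] [CharZero K] : Bialgebra K (Sym K) :=
  Bialgebra.ofAlgHom (comulHom K) (counitHom K)
    (hom_ext fun n => by
      simp [TensorProduct.tmul_add, TensorProduct.add_tmul, Algebra.TensorProduct.one_def, add_assoc])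
    (hom_ext fun n => by simp)
    (hom_ext fun n => by simp)

theorem comulAlgHom_powSum [CharZero K] (n : ℕ+) :
    Bialgebra.comulAlgHom K (Sym K) (powSum K n) = powSum K n ⊗ₜ 1 + 1 ⊗ₜ powSum K n :=
  comulHom_powSum n

theorem counitAlgHom_powSum [CharZero K] (n : ℕ+) :
    Bialgebra.counitAlgHom K (Sym K) (powSum K n) = 0 := counitHom_powSum n

instance (K : Type*) [Field K] [CharZero K] : HopfAlgebra K (Sym K) :=
  HopfAlgebra.ofAlgHom (antipodeHom K)
    (hom_ext fun n => by
      rw [AlgHom.comp_apply, AlgHom.comp_apply, comulAlgHom_powSum, counitAlgHom_powSum, map_add]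
      refine (congrArg₂ (· + ·) (Algebra.TensorProduct.lift_tmul _ _ _ _ _)
        (Algebra.TensorProduct.lift_tmul _ _ _ _ _)).trans ?_
      simp)
    (hom_ext fun n => by
      rw [AlgHom.comp_apply, AlgHom.comp_apply, comulAlgHom_powSum, counitAlgHom_powSum, map_add]
      refine (congrArg₂ (· + ·) (Algebra.TensorProduct.lift_tmul _ _ _ _ _)
        (Algebra.TensorProduct.lift_tmul _ _ _ _ _)).trans ?_
      simp)

theorem antipode_powSum [CharZero K] (n : ℕ+) :
    HopfAlgebra.antipode K (powSum K n) = -powSum K n := antipodeHom_powSum n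

/-- The homogeneous symmetric functions of degree `n`. -/
def grading (K : Type*) [Field K] (n : ℕ) : Submodule K (Sym K) where
  carrier := {f | ∀ d : ℕ →₀ ℕ, cf d f ≠ 0 → d.degree = n}
  add_mem' {f g} hf hg d hd := by
    by_cases h : cf d f = 0
    · exact hg d fun h' => hd (by rw [map_add, h, h', add_zero])
    · exact hf d h
  zero_mem' d hd := absurd (map_zero _) hd
  smul_mem' c f hf d hd := hf d fun h => hd (by rw [map_smul, h, smul_zero])

/-! ### The ring `Λ̃` -/

/-- The vector space `Λ̃`, which is the same as the vector space `Λ`. It carries the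
multiplication `⊙` instead of the usual one. -/
def SymT (K : Type*) [Field K] : Type _ := Sym K

instance (K : Type*) [Field K] : AddCommGroup (SymT K) := inferInstanceAs (AddCommGroup (Sym K))

instance (K : Type*) [Field K] : Module K (SymT K) := inferInstanceAs (Module K (Sym K))

/-- The identity map `Λ → Λ̃` of vector spaces (it is not multiplicative). -/
def toT (K : Type*) [Field K] : Sym K ≃ₗ[K] SymT K := LinearEquiv.refl K (Sym K)

/-- The basis `m̃_λ` of `Λ̃`. -/
def augMonoBasisT (K : Type*) [Field K] [CharZero K] : Module.Basis Ptn K (SymT K) :=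
  (augMonoBasis K).map (toT K)

/-- The coordinates of an element of `Λ̃` in the basis `m̃_λ`, as an element of the monoid algebra of
the monoid of partitions under `⊔`. -/
def coordT (K : Type*) [Field K] [CharZero K] : SymT K ≃ₗ[K] AddMonoidAlgebra K Ptn :=
  (augMonoBasisT K).repr.trans (AddMonoidAlgebra.coeffLinearEquiv K).symm

/-- The element `m̃_λ` of `Λ̃`. -/
def augMonoT (K : Type*) [Field K] (lam : Ptn) : SymT K := toT K (augMono K lam)

/-- The multiplication `⊙` of `Λ̃`: the bilinear extension of `m̃_λ ⊙ m̃_μ = m̃_{λ ⊔ μ}`. -/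
instance (K : Type*) [Field K] [CharZero K] : Mul (SymT K) :=
  ⟨fun f g => (coordT K).symm (coordT K f * coordT K g)⟩

instance (K : Type*) [Field K] [CharZero K] : One (SymT K) := ⟨augMonoT K 0⟩

theorem coordT_augMonoT [CharZero K] (lam : Ptn) :
    coordT K (augMonoT K lam) = AddMonoidAlgebra.single lam 1 := by
  have : augMonoT K lam = augMonoBasisT K lam := by
    rw [augMonoBasisT, Module.Basis.map_apply, augMonoBasis_apply]
    rfl
  rw [this, coordT, LinearEquiv.trans_apply, Module.Basis.repr_self]
  rfl

theorem coordT_mul [CharZero K] (f g : SymT K) : coordT K (f * g) = coordT K f * coordT K g :=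
  (coordT K).apply_symm_apply _

theorem coordT_one [CharZero K] : coordT K (1 : SymT K) = 1 := coordT_augMonoT 0

theorem augMonoT_mul [CharZero K] (lam mu : Ptn) :
    augMonoT K lam * augMonoT K mu = augMonoT K (lam + mu) := by
  apply (coordT K).injective
  rw [coordT_mul, coordT_augMonoT, coordT_augMonoT, coordT_augMonoT,
    AddMonoidAlgebra.single_mul_single, one_mul]

instance (K : Type*) [Field K] [CharZero K] : CommRing (SymT K) :=
  { (inferInstance : AddCommGroup (SymT K)), (inferInstance : Mul (SymT K)),
    (inferInstance : One (SymT K)) with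
    left_distrib := fun f g h => (coordT K).injective (by simp only [coordT_mul, map_add, mul_add])
    right_distrib := fun f g h => (coordT K).injective (by simp only [coordT_mul, map_add, add_mul])
    zero_mul := fun f => (coordT K).injective (by rw [coordT_mul, map_zero, zero_mul])
    mul_zero := fun f => (coordT K).injective (by rw [coordT_mul, map_zero, mul_zero])
    mul_assoc := fun f g h => (coordT K).injective (by simp only [coordT_mul, mul_assoc])
    one_mul := fun f => (coordT K).injective (by rw [coordT_mul, coordT_one, one_mul])
    mul_one := fun f => (coordT K).injective (by rw [coordT_mul, coordT_one, mul_one])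
    mul_comm := fun f g => (coordT K).injective (by rw [coordT_mul, coordT_mul, mul_comm]) }

instance (K : Type*) [Field K] [CharZero K] : Algebra K (SymT K) :=
  Algebra.ofModule
    (fun r f g => (coordT K).injective (by
      rw [map_smul, coordT_mul, coordT_mul, map_smul, smul_mul_assoc]))
    (fun r f g => (coordT K).injective (by
      rw [map_smul, coordT_mul, coordT_mul, map_smul, mul_smul_comm]))

/-- `Λ̃` has the same coproduct and the same counit as `Λ`. -/
instance (K : Type*) [Field K] [CharZero K] : Coalgebra K (SymT K) :=
  inferInstanceAs (Coalgebra K (Sym K))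

theorem comul_toT [CharZero K] (f : Sym K) : Coalgebra.comul (R := K) (toT K f) =
    TensorProduct.map (toT K).toLinearMap (toT K).toLinearMap (Coalgebra.comul (R := K) f) := by
  change Coalgebra.comul (R := K) f = TensorProduct.map LinearMap.id LinearMap.id _
  simp

theorem counit_toT [CharZero K] (f : Sym K) :
    Coalgebra.counit (R := K) (toT K f) = Coalgebra.counit (R := K) f := rfl

/-- The grading of `Λ̃`, which is the same as that of `Λ`: by degree. -/
def gradingT (K : Type*) [Field K] [CharZero K] (n : ℕ) : Submodule K (SymT K) :=
  (grading K n).map (toT K).toLinearMap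

/-! ### Graded Hopf algebras -/

/-- For an algebra and coalgebra `A` over `K`, the linear map `S` and the
submodules `𝒜 n` make `A` into a graded Hopf algebra with antipode `S`. -/
structure IsGradedHopfAlgebra (K : Type*) {A : Type*} [Field K] [Ring A] [Algebra K A]
    [Coalgebra K A] (S : A →ₗ[K] A) (𝒜 : ℕ → Submodule K A) : Prop where
  counit_one : Coalgebra.counit (R := K) (1 : A) = 1
  counit_mul : ∀ f g : A, Coalgebra.counit (R := K) (f * g) =
    Coalgebra.counit (R := K) f * Coalgebra.counit (R := K) g
  comul_one : Coalgebra.comul (R := K) (1 : A) = 1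
  comul_mul : ∀ f g : A, Coalgebra.comul (R := K) (f * g) =
    Coalgebra.comul (R := K) f * Coalgebra.comul (R := K) g
  mul_antipode_rTensor_comul : LinearMap.mul' K A ∘ₗ S.rTensor A ∘ₗ Coalgebra.comul =
    Algebra.linearMap K A ∘ₗ Coalgebra.counit
  mul_antipode_lTensor_comul : LinearMap.mul' K A ∘ₗ S.lTensor A ∘ₗ Coalgebra.comul =
    Algebra.linearMap K A ∘ₗ Coalgebra.counit
  isInternal : DirectSum.IsInternal 𝒜
  one_mem : (1 : A) ∈ 𝒜 0
  mul_mem : ∀ {m n : ℕ} {f g : A}, f ∈ 𝒜 m → g ∈ 𝒜 n → f * g ∈ 𝒜 (m + n)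
  comul_mem : ∀ {n : ℕ} {f : A}, f ∈ 𝒜 n → Coalgebra.comul (R := K) f ∈
    ⨆ p ∈ Finset.HasAntidiagonal.antidiagonal n,
      LinearMap.range (TensorProduct.map (𝒜 p.1).subtype (𝒜 p.2).subtype)
  counit_eq_zero : ∀ {n : ℕ} {f : A}, f ∈ 𝒜 n → n ≠ 0 → Coalgebra.counit (R := K) f = 0
  antipode_mem : ∀ {n : ℕ} {f : A}, f ∈ 𝒜 n → S f ∈ 𝒜 n

/-- The Hopf algebra in the sense of Mathlib underlying a graded Hopf algebra. -/
abbrev IsGradedHopfAlgebra.toHopfAlgebra {K A : Type*} [Field K] [Ring A] [Algebra K A]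
    [Coalgebra K A] {S : A →ₗ[K] A} {𝒜 : ℕ → Submodule K A} (h : IsGradedHopfAlgebra K S 𝒜) :
    HopfAlgebra K A :=
  { Bialgebra.mk' K A h.counit_one (h.counit_mul _ _) h.comul_one (h.comul_mul _ _) with
    antipode := S
    mul_antipode_rTensor_comul := h.mul_antipode_rTensor_comul
    mul_antipode_lTensor_comul := h.mul_antipode_lTensor_comul }

end SymmFun

end

noncomputable section

namespace SymmFun

variable {K : Type*} [Field K]

/-! Everything rests on the product rule `powSum_mul_augMono_eq`: `p_n m̃_λ` is `m̃_{λ ⊔ n}` plus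
the sum, over the parts `k` of `λ`, of the `m̃` obtained by replacing `k` by `n + k`. Read in `Λ̃`,
it says that multiplication by `p_n` is the operator `m̃_n ⊙ · + D_n`, where `D_n` (`shiftT`) is the
derivation for `⊙` with `m̃_k ↦ m̃_{n+k}`.

The only real issue is that the coproduct `Δ`, which is multiplicative for the product of `Λ`, is
also multiplicative for `⊙`. Let `δ` (`comulT`) be the algebra homomorphism of `Λ̃` making every
`m̃_n` primitive. The derivation `D_n ⊗ 1 + 1 ⊗ D_n` sends `δ(m̃_k)` to `δ(m̃_{n+k})`, so it
intertwines with `D_n` through `δ` (`shiftTensor_comulT`). Hence `δ(p_n f)` is obtained from `δ(f)`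
by applying the operator `δ(m̃_n) · + D_n ⊗ 1 + 1 ⊗ D_n`. This operator is multiplication by `p_n ⊗
1 + 1 ⊗ p_n` in `Λ ⊗ Λ` (`map_toT_mul`), so `Δ` obeys the same recursion. Both take `1` to `1 ⊗ 1`,
so they agree on every `p_λ`, and `Δ = δ` (`comul_eq_comulT`).

The map `p_λ ↦ m̃_λ` is an algebra isomorphism matching two bases, and it sends the primitive
generators `p_n` to the primitive generators `m̃_n`; so it respects the coproduct, and the antipode
of `Λ` can be transported along it. It respects degrees because each homogeneous component is
spanned both by the `p_λ` and by the `m̃_λ` with `λ` of the given size (`grading_eq_span`). -/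

theorem _root_.Module.Basis.induction_on {R M ι : Type*} [Semiring R] [AddCommMonoid M] [Module R M]
    (b : Module.Basis ι R M) {motive : M → Prop} (f : M) (zero : motive 0)
    (add : ∀ f g, motive f → motive g → motive (f + g))
    (smul : ∀ (c : R) f, motive f → motive (c • f)) (basis : ∀ i, motive (b i)) : motive f := by
  have hf : f ∈ Submodule.span R (Set.range b) := b.span_eq ▸ Submodule.mem_top
  induction hf using Submodule.span_induction with
  | mem f hf => obtain ⟨i, rfl⟩ := hf; exact basis i
  | zero => exact zero
  | add f g _ _ hf hg => exact add f g hf hg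
  | smul c f _ hf => exact smul c f hf

/-! ### Multiplication of augmented monomials by power sums -/

/-- These terms account for `x_i ^ n` in a variable absent from the other factor. The `count n lam +
1` choices of `i` each contribute `zee lam`, which is exactly the recursion `zee_cons`. -/
theorem sum_filter_eq_augMono (n : ℕ+) (lam : Ptn) (d : ℕ →₀ ℕ) :
    ∑ i ∈ d.support.filter (fun i => d i = n), cf (d - Finsupp.single i (n : ℕ)) (augMono K lam) =
      cf d (augMono K (n ::ₘ lam)) := by
  have h : ∀ i ∈ d.support.filter (fun i => d i = n),
      cf (d - Finsupp.single i (n : ℕ)) (augMono K lam) =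
        if typ d = n ::ₘ lam then (zee lam : K) else 0 := fun i hi => by
    rw [cf_augMono, typ_tsub d i n (Finset.mem_filter.1 hi).2]
    simp only [Multiset.cons_inj_right]
  rw [Finset.sum_congr rfl h, Finset.sum_const, ← count_typ, cf_augMono]
  split_ifs with hd
  · rw [hd, Multiset.count_cons_self, zee_cons, nsmul_eq_mul]
    push_cast
    rfl
  · simp

theorem typ_tsub_of_eq_add (d : ℕ →₀ ℕ) (i : ℕ) (n k : ℕ+) (h : d i = n + k) :
    ∃ nu : Ptn, typ d = (n + k) ::ₘ nu ∧ typ (d - Finsupp.single i (n : ℕ)) = k ::ₘ nu := by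
  refine ⟨_, typ_tsub d i (n + k) (by simpa using h), ?_⟩
  rw [typ_tsub (d - Finsupp.single i (n : ℕ)) i k (by simp [h]), tsub_tsub,
    ← Finsupp.single_add, PNat.add_coe]

theorem count_mul_zee_erase {lam : Ptn} {k : ℕ+} (hk : k ∈ lam) :
    lam.count k * zee (lam.erase k) = zee lam := by
  conv_rhs => rw [← Multiset.cons_erase hk, zee_cons]
  rw [Multiset.count_erase_self, Nat.sub_add_cancel (Multiset.count_pos.2 hk)]

/-- Lowering an exponent `n + k` by `n` turns a part `n + k` into a part `k`; so these terms account
for `x_i ^ n` merging with a part equal to `k`. -/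
theorem sum_filter_eq_add_augMono (n k : ℕ+) {lam : Ptn} (hk : k ∈ lam) (d : ℕ →₀ ℕ) :
    ∑ i ∈ d.support.filter (fun i => d i = n + k),
        cf (d - Finsupp.single i (n : ℕ)) (augMono K lam) =
      lam.count k • cf d (augMono K ((n + k) ::ₘ lam.erase k)) := by
  have h : ∀ i ∈ d.support.filter (fun i => d i = n + k),
      cf (d - Finsupp.single i (n : ℕ)) (augMono K lam) =
        if typ d = (n + k) ::ₘ lam.erase k then (zee lam : K) else 0 := fun i hi => by
    obtain ⟨nu, h1, h2⟩ := typ_tsub_of_eq_add d i n k (Finset.mem_filter.1 hi).2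
    rw [cf_augMono, h1, h2]
    refine if_congr ?_ rfl rfl
    conv_lhs => rw [← Multiset.cons_erase hk]
    simp only [Multiset.cons_inj_right]
  rw [Finset.sum_congr rfl h, Finset.sum_const, ← PNat.add_coe, ← count_typ, cf_augMono]
  -- With `mu = lam.erase k`, both sides are `(mu.count (n + k) + 1) * lam.count k * zee mu`.
  split_ifs with hd
  · rw [hd, Multiset.count_cons_self, zee_cons, ← count_mul_zee_erase hk, nsmul_eq_mul,
      nsmul_eq_mul]
    push_cast
    ring
  · simp

/-- The indices are sorted by the excess `k = d i - n`. An excess that is not a part of `lam`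
contributes nothing, and the others are counted with multiplicity by the multiset sum. -/
theorem sum_filter_lt_augMono (n : ℕ+) (lam : Ptn) (d : ℕ →₀ ℕ) :
    ∑ i ∈ d.support.filter (fun i => (n : ℕ) < d i),
        cf (d - Finsupp.single i (n : ℕ)) (augMono K lam) =
      cf d (lam.map fun k => augMono K ((n + k) ::ₘ lam.erase k)).sum := by
  rw [Finset.sum_multiset_map_count, map_sum]
  have h : ∀ k ∈ lam.toFinset, cf d (lam.count k • augMono K ((n + k) ::ₘ lam.erase k)) =
      ∑ i ∈ d.support.filter (fun i => d i = n + k),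
        cf (d - Finsupp.single i (n : ℕ)) (augMono K lam) := fun k hk => by
    rw [sum_filter_eq_add_augMono n k (Multiset.mem_toFinset.1 hk), map_nsmul]
  rw [Finset.sum_congr rfl h, Finset.sum_sigma']
  symm
  -- Forgetting `k` is injective, since `k` is recovered as `d i - n`.
  refine Finset.sum_of_injOn (fun p => p.2) ?_ ?_ ?_ fun _ _ => rfl
  · rintro ⟨k, i⟩ hp ⟨l, j⟩ hq (rfl : i = j)
    simp only [Finset.coe_sigma, Set.mem_sigma_iff, Finset.mem_coe, Finset.mem_filter] at hp hq
    have : k = l := PNat.eq (by have := hp.2.2; have := hq.2.2; omega)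
    rw [this]
  · rintro ⟨k, i⟩ hp
    simp only [Finset.coe_sigma, Set.mem_sigma_iff, Finset.mem_coe, Finset.mem_filter] at hp ⊢
    exact ⟨hp.2.1, by have := hp.2.2; have := k.pos; omega⟩
  · intro i hi h
    rw [Finset.mem_filter] at hi
    rw [cf_augMono]
    refine if_neg fun hl => h ?_
    have hk : d i = n + (⟨d i - n, by omega⟩ : ℕ+) := by
      change d i = n + (d i - n)
      omega
    obtain ⟨nu, -, h2⟩ := typ_tsub_of_eq_add d i n _ hk
    refine ⟨⟨⟨d i - n, by omega⟩, i⟩, ?_, rfl⟩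
    simp only [Finset.coe_sigma, Set.mem_sigma_iff, Finset.mem_coe, Finset.mem_filter]
    exact ⟨Multiset.mem_toFinset.2 (by rw [← hl, h2]; exact Multiset.mem_cons_self _ _), hi.1, hk⟩

/-- In a monomial of the product, the factor `x_i ^ n` either uses up the whole exponent of `x_i`,
giving a new part `n`, or merges with an existing part. -/
theorem powSum_mul_augMono_eq (n : ℕ+) (lam : Ptn) :
    powSum K n * augMono K lam = augMono K (n ::ₘ lam) +
      (lam.map fun k => augMono K ((n + k) ::ₘ lam.erase k)).sum := by
  refine cf_ext fun d => ?_
  rw [cf_powSum_mul, map_add, ← sum_filter_eq_augMono, ← sum_filter_lt_augMono,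
    ← Finset.sum_union (Finset.disjoint_filter.2 fun i _ h1 h2 => by omega), ← Finset.filter_or]
  refine Finset.sum_congr (Finset.filter_congr fun i _ => ?_) fun _ _ => rfl
  omega

/-! ### Gradings -/

/-- Replacing all `s j` with `j ≠ i` by their supremum, the modular law gives `s i ≤ t i ⊔ (s i ⊓ ⨆
j ≠ i, s j)`, and independence kills the last term. -/
theorem _root_.iSupIndep.eq_of_le_of_iSup_eq_top {ι α : Type*} [CompleteLattice α]
    [IsModularLattice α] {s t : ι → α} (hs : iSupIndep s) (hts : ∀ i, t i ≤ s i)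
    (ht : ⨆ i, t i = ⊤) (i : ι) : s i = t i := by
  refine le_antisymm ?_ (hts i)
  have h1 : (⊤ : α) ≤ t i ⊔ ⨆ (j) (_ : j ≠ i), s j := by
    rw [← ht]
    refine iSup_le fun j => ?_
    by_cases hj : j = i
    · exact hj ▸ le_sup_left
    · exact (hts j).trans (le_sup_of_le_right (le_iSup₂_of_le j hj le_rfl))
  calc s i ≤ (t i ⊔ ⨆ (j) (_ : j ≠ i), s j) ⊓ s i := le_inf (le_top.trans h1) le_rfl
    _ ≤ t i ⊔ (⨆ (j) (_ : j ≠ i), s j) ⊓ s i := sup_inf_le_assoc_of_le _ (hts i)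
    _ = t i := by rw [inf_comm, (hs i).eq_bot, sup_bot_eq]

/-- The sum of the parts of a partition. -/
def size (lam : Ptn) : ℕ := (lam.map fun n : ℕ+ => (n : ℕ)).sum

theorem size_cons (n : ℕ+) (lam : Ptn) : size (n ::ₘ lam) = n + size lam := by simp [size]

theorem augMono_mem_grading (lam : Ptn) : augMono K lam ∈ grading K (size lam) := by
  intro d hd
  rw [cf_augMono] at hd
  rw [← sum_typ, (ite_ne_right_iff.1 hd).1, size]

theorem mul_mem_grading {m n : ℕ} {f g : Sym K} (hf : f ∈ grading K m) (hg : g ∈ grading K n) :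
    f * g ∈ grading K (m + n) := by
  intro d hd
  have h : cf d (f * g) = ∑ p ∈ Finset.HasAntidiagonal.antidiagonal d, cf p.1 f * cf p.2 g :=
    MvPowerSeries.coeff_mul ..
  rw [h] at hd
  obtain ⟨p, hp, hpd⟩ := Finset.exists_ne_zero_of_sum_ne_zero hd
  rw [Finset.HasAntidiagonal.mem_antidiagonal] at hp
  rw [← hp, map_add, hf _ (left_ne_zero_of_mul hpd), hg _ (right_ne_zero_of_mul hpd)]

theorem powSum_eq_augMono (n : ℕ+) : powSum K n = augMono K {n} := by
  have h := powSum_mul_augMono_eq (K := K) n 0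
  rw [augMono_zero, mul_one] at h
  rw [h]
  simp

theorem powSumPtn_mem_grading (lam : Ptn) : powSumPtn K lam ∈ grading K (size lam) := by
  induction lam using Multiset.induction with
  | empty =>
    have : powSumPtn K 0 = augMono K 0 := by rw [augMono_zero]; simp [powSumPtn]
    rw [this]
    exact augMono_mem_grading 0
  | cons n lam ih =>
    rw [powSumPtn_cons, size_cons]
    refine mul_mem_grading ?_ ih
    rw [powSum_eq_augMono]
    simpa [size] using augMono_mem_grading (K := K) {n}

theorem iSupIndep_grading : iSupIndep (grading K) := by
  intro n
  -- `N` consists of the functions without terms of degree `n`. It contains all other components and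
  -- meets the `n`-th one trivially.
  let N : Submodule K (Sym K) := ⨅ (d : ℕ →₀ ℕ) (_ : d.degree = n), LinearMap.ker (cf d)
  have hN : ⨆ (m) (_ : m ≠ n), grading K m ≤ N := by
    refine iSup₂_le fun m hm f hf => ?_
    simp only [N, Submodule.mem_iInf, LinearMap.mem_ker]
    intro d hd
    by_contra h
    exact hm ((hf d h).symm.trans hd)
  refine Disjoint.mono_right hN ?_
  rw [Submodule.disjoint_def]
  intro f hf hfN
  simp only [N, Submodule.mem_iInf, LinearMap.mem_ker] at hfN
  refine cf_ext fun d => ?_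
  rw [map_zero]
  by_contra h
  exact h (hfN d (hf d h))

/-- The spans lie inside the independent homogeneous components and together fill `Λ`, so no
inclusion can be strict. This serves both for the `m̃_λ` and for the `p_λ`. -/
theorem grading_eq_span (b : Module.Basis Ptn K (Sym K))
    (hb : ∀ lam, b lam ∈ grading K (size lam)) (n : ℕ) :
    grading K n = Submodule.span K (b '' {lam | size lam = n}) := by
  refine iSupIndep_grading.eq_of_le_of_iSup_eq_top
    (t := fun n => Submodule.span K (b '' {lam | size lam = n})) (fun n => ?_) ?_ n
  · rw [Submodule.span_le]
    rintro _ ⟨lam, rfl, rfl⟩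
    exact hb lam
  · rw [eq_top_iff, ← b.span_eq, Submodule.span_le]
    rintro _ ⟨lam, rfl⟩
    exact Submodule.mem_iSup_of_mem (size lam) (Submodule.subset_span ⟨lam, rfl, rfl⟩)

/-! ### The comultiplication in terms of `⊙` -/

variable [CharZero K]

theorem augMonoBasisT_apply (lam : Ptn) : augMonoBasisT K lam = augMonoT K lam := by
  rw [augMonoBasisT, Module.Basis.map_apply, augMonoBasis_apply]
  rfl

theorem augMonoT_zero : augMonoT K 0 = 1 := rfl

theorem augMonoT_cons (n : ℕ+) (lam : Ptn) :
    augMonoT K (n ::ₘ lam) = augMonoT K {n} * augMonoT K lam := by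
  rw [augMonoT_mul, Multiset.singleton_add]

/-- The derivation of `Λ̃` with `m̃_k ↦ m̃_{n+k}`, as a linear map. -/
def shiftT (K : Type*) [Field K] [CharZero K] (n : ℕ+) : SymT K →ₗ[K] SymT K :=
  (augMonoBasisT K).constr K fun lam =>
    (lam.map fun k => augMonoT K ((n + k) ::ₘ lam.erase k)).sum

theorem shiftT_augMonoT (n : ℕ+) (lam : Ptn) : shiftT K n (augMonoT K lam) =
    (lam.map fun k => augMonoT K ((n + k) ::ₘ lam.erase k)).sum := by
  rw [← augMonoBasisT_apply, shiftT, Module.Basis.constr_basis]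

theorem shiftT_one (n : ℕ+) : shiftT K n 1 = 0 := by
  rw [← augMonoT_zero, shiftT_augMonoT]
  simp

/-- The Leibniz rule, with a generator as left factor; inductions on the parts of a partition need
no more. -/
theorem shiftT_mul (n k : ℕ+) (f : SymT K) : shiftT K n (augMonoT K {k} * f) =
    augMonoT K {n + k} * f + augMonoT K {k} * shiftT K n f := by
  induction f using (augMonoBasisT K).induction_on with
  | zero => simp
  | add f g hf hg => rw [mul_add, map_add, hf, hg, mul_add, map_add, mul_add]; abel
  | smul c f hf => rw [mul_smul_comm, map_smul, hf, map_smul, smul_add, mul_smul_comm, mul_smul_comm]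
  | basis lam =>
    rw [augMonoBasisT_apply, ← augMonoT_cons, shiftT_augMonoT, shiftT_augMonoT, Multiset.map_cons,
      Multiset.sum_cons, Multiset.erase_cons_head, augMonoT_cons, ← Multiset.sum_map_mul_left]
    congr 2
    refine Multiset.map_congr rfl fun j hj => ?_
    rw [← augMonoT_cons, Multiset.erase_cons_tail_of_mem hj, Multiset.cons_swap]

theorem toT_powSum_mul (n : ℕ+) (f : Sym K) :
    toT K (powSum K n * f) = augMonoT K {n} * toT K f + shiftT K n (toT K f) := by
  induction f using (augMonoBasis K).induction_on with
  | zero => simp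
  | add f g hf hg => rw [mul_add, map_add, hf, hg, map_add, mul_add, map_add]; abel
  | smul c f hf => rw [mul_smul_comm, map_smul, hf, map_smul, smul_add, mul_smul_comm, map_smul]
  | basis lam =>
    rw [augMonoBasis_apply, powSum_mul_augMono_eq, map_add, ← augMonoT, ← augMonoT, augMonoT_cons,
      shiftT_augMonoT, map_multiset_sum, Multiset.map_map]
    rfl

/-! ### The algebra isomorphism and the candidate coproduct. -/

theorem lift_powSumPtn (lam : Ptn) :
    lift (fun n => augMonoT K {n}) (powSumPtn K lam) = augMonoT K lam := by
  induction lam using Multiset.induction with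
  | empty => rw [powSumPtn, Multiset.map_zero, Multiset.prod_zero, map_one, augMonoT_zero]
  | cons n lam ih => rw [powSumPtn_cons, map_mul, ih, lift_powSum, augMonoT_cons]

/-- The algebra isomorphism `Λ → Λ̃` with `p_λ ↦ m̃_λ`. -/
def powToAug (K : Type*) [Field K] [CharZero K] : Sym K ≃ₐ[K] SymT K :=
  AlgEquiv.ofBijective (lift fun n => augMonoT K {n}) <| by
    -- Bijectivity holds because the basis `p_λ` is carried to the basis `m̃_λ`.
    have h : (lift fun n => augMonoT K {n} : Sym K →ₐ[K] SymT K).toLinearMap =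
        ((powSumBasis K).equiv (augMonoBasisT K) (Equiv.refl _)).toLinearMap := by
      refine (powSumBasis K).ext fun lam => ?_
      rw [LinearEquiv.coe_coe, Module.Basis.equiv_apply, powSumBasis_apply, augMonoBasisT_apply]
      exact lift_powSumPtn lam
    have h2 : ⇑(lift fun n => augMonoT K {n} : Sym K →ₐ[K] SymT K) =
        (powSumBasis K).equiv (augMonoBasisT K) (Equiv.refl _) :=
      funext fun x => LinearMap.congr_fun h x
    rw [h2]
    exact LinearEquiv.bijective _

theorem powToAug_powSumPtn (lam : Ptn) : powToAug K (powSumPtn K lam) = augMonoT K lam :=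
  lift_powSumPtn lam

theorem powToAug_powSum (n : ℕ+) : powToAug K (powSum K n) = augMonoT K {n} := lift_powSum _ n

theorem powToAug_symm_augMonoT (n : ℕ+) :
    (powToAug K).symm (augMonoT K {n}) = powSum K n := by
  rw [← powToAug_powSum, AlgEquiv.symm_apply_apply]

/-- The algebra homomorphism `Λ̃ → Λ̃ ⊗ Λ̃` with `m̃_n ↦ m̃_n ⊗ 1 + 1 ⊗ m̃_n`. -/
def comulT (K : Type*) [Field K] [CharZero K] : SymT K →ₐ[K] SymT K ⊗[K] SymT K :=
  (lift fun n => augMonoT K {n} ⊗ₜ 1 + 1 ⊗ₜ augMonoT K {n}).comp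
    ((powToAug K).symm : SymT K →ₐ[K] Sym K)

theorem comulT_augMonoT (n : ℕ+) :
    comulT K (augMonoT K {n}) = augMonoT K {n} ⊗ₜ 1 + 1 ⊗ₜ augMonoT K {n} := by
  have h : ((powToAug K).symm : SymT K →ₐ[K] Sym K) (augMonoT K {n}) = powSum K n :=
    powToAug_symm_augMonoT n
  rw [comulT, AlgHom.comp_apply, h, lift_powSum]

/-- The derivation `D ⊗ 1 + 1 ⊗ D` of `Λ̃ ⊗ Λ̃`, where `D` is the derivation of `Λ̃`
with `m̃_k ↦ m̃_{n+k}`. -/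
def shiftTensor (K : Type*) [Field K] [CharZero K] (n : ℕ+) :
    SymT K ⊗[K] SymT K →ₗ[K] SymT K ⊗[K] SymT K :=
  (shiftT K n).rTensor _ + (shiftT K n).lTensor _

theorem shiftTensor_tmul (n : ℕ+) (f g : SymT K) :
    shiftTensor K n (f ⊗ₜ g) = shiftT K n f ⊗ₜ g + f ⊗ₜ shiftT K n g := rfl

theorem shiftTensor_mul (n k : ℕ+) (t : SymT K ⊗[K] SymT K) :
    shiftTensor K n (comulT K (augMonoT K {k}) * t) =
      comulT K (augMonoT K {n + k}) * t + comulT K (augMonoT K {k}) * shiftTensor K n t := by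
  induction t using TensorProduct.induction_on with
  | zero => simp
  | add t u ht hu => rw [mul_add, map_add, ht, hu, mul_add, map_add, mul_add]; abel
  | tmul f g =>
    simp only [comulT_augMonoT, shiftTensor_tmul, add_mul, mul_add, map_add,
      Algebra.TensorProduct.tmul_mul_tmul, one_mul, shiftT_mul, TensorProduct.add_tmul,
      TensorProduct.tmul_add]
    abel

theorem shiftTensor_comulT (n : ℕ+) (f : SymT K) :
    shiftTensor K n (comulT K f) = comulT K (shiftT K n f) := by
  induction f using (augMonoBasisT K).induction_on with
  | zero => simp
  | add f g hf hg => simp only [map_add, hf, hg]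
  | smul c f hf => simp only [map_smul, hf]
  | basis lam =>
    rw [augMonoBasisT_apply]
    induction lam using Multiset.induction with
    | empty =>
      rw [augMonoT_zero, shiftT_one, map_one, map_zero, Algebra.TensorProduct.one_def,
        shiftTensor_tmul, shiftT_one, TensorProduct.zero_tmul, TensorProduct.tmul_zero, add_zero]
    | cons k lam ih =>
      rw [augMonoT_cons, map_mul, shiftTensor_mul, ih, shiftT_mul, map_add, map_mul, map_mul]

/-- The tensor form of `toT_powSum_mul`: the operator `m̃_n ⊙ · + D_n` acts on each factor in turn.
-/
theorem map_toT_mul (n : ℕ+) (t : Sym K ⊗[K] Sym K) :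
    TensorProduct.map (toT K).toLinearMap (toT K).toLinearMap
        ((powSum K n ⊗ₜ 1 + 1 ⊗ₜ powSum K n) * t) =
      comulT K (augMonoT K {n}) *
          TensorProduct.map (toT K).toLinearMap (toT K).toLinearMap t +
        shiftTensor K n (TensorProduct.map (toT K).toLinearMap (toT K).toLinearMap t) := by
  induction t using TensorProduct.induction_on with
  | zero => simp
  | add t u ht hu => simp only [mul_add, map_add, ht, hu]; abel
  | tmul f g =>
    simp only [comulT_augMonoT, shiftTensor_tmul, add_mul, map_add, TensorProduct.map_tmul,
      Algebra.TensorProduct.tmul_mul_tmul, one_mul, LinearEquiv.coe_coe, toT_powSum_mul,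
      TensorProduct.add_tmul, TensorProduct.tmul_add]
    abel

theorem comul_eq_comulT (f : SymT K) : Coalgebra.comul (R := K) f = comulT K f := by
  obtain ⟨f, rfl⟩ := (toT K).surjective f
  -- The basis `p_λ` is the suitable one, as `Δ` is known on products taken in `Λ`.
  induction f using (powSumBasis K).induction_on with
  | zero => simp
  | add f g hf hg => simp only [map_add, hf, hg]
  | smul c f hf => simp only [map_smul, hf]
  | basis lam =>
    rw [powSumBasis_apply]
    induction lam using Multiset.induction with
    | empty =>
      have : toT K (1 : Sym K) = 1 := by rw [← augMono_zero]; rfl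
      rw [powSumPtn, Multiset.map_zero, Multiset.prod_zero, comul_toT, Bialgebra.comul_one, this,
        map_one (comulT K), Algebra.TensorProduct.one_def, TensorProduct.map_tmul, LinearEquiv.coe_coe, this,
        ← Algebra.TensorProduct.one_def]
    | cons n lam ih =>
      have h : Coalgebra.comul (R := K) (powSum K n) = powSum K n ⊗ₜ 1 + 1 ⊗ₜ powSum K n :=
        comulHom_powSum n
      rw [comul_toT] at ih
      rw [powSumPtn_cons, comul_toT, Bialgebra.comul_mul, h, map_toT_mul, ih, toT_powSum_mul,
        map_add, map_mul, shiftTensor_comulT]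

/-! ### The grading of `Λ̃` -/

theorem grading_eq_span_augMono (n : ℕ) :
    grading K n = Submodule.span K (augMono K '' {lam | size lam = n}) := by
  have h := grading_eq_span (augMonoBasis K)
    (fun lam => by rw [augMonoBasis_apply]; exact augMono_mem_grading lam) n
  simpa only [augMonoBasis_apply] using h

theorem grading_eq_span_powSumPtn (n : ℕ) :
    grading K n = Submodule.span K (powSumPtn K '' {lam | size lam = n}) := by
  have h := grading_eq_span (powSumBasis K)
    (fun lam => by rw [powSumBasis_apply]; exact powSumPtn_mem_grading lam) n
  simpa only [powSumBasis_apply] using h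

theorem gradingT_eq_span (n : ℕ) :
    gradingT K n = Submodule.span K (augMonoT K '' {lam | size lam = n}) := by
  rw [gradingT, grading_eq_span_augMono, Submodule.map_span, ← Set.image_comp]
  rfl

theorem map_powToAug_grading (n : ℕ) :
    (grading K n).map (powToAug K).toLinearMap = gradingT K n := by
  rw [gradingT_eq_span, grading_eq_span_powSumPtn, Submodule.map_span, ← Set.image_comp]
  congr 1
  exact Set.image_congr fun lam _ => powToAug_powSumPtn lam

theorem mem_gradingT_iff {n : ℕ} {f : SymT K} :
    f ∈ gradingT K n ↔ (powToAug K).symm f ∈ grading K n := by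
  rw [← map_powToAug_grading]
  constructor
  · rintro ⟨f, hf, rfl⟩
    rwa [AlgEquiv.toLinearMap_apply, AlgEquiv.symm_apply_apply]
  · exact fun h => ⟨_, h, (powToAug K).apply_symm_apply f⟩

theorem augMonoT_mem_gradingT (lam : Ptn) : augMonoT K lam ∈ gradingT K (size lam) :=
  Submodule.mem_map_of_mem (augMono_mem_grading lam)

theorem augMonoT_singleton_mem_gradingT (n : ℕ+) : augMonoT K {n} ∈ gradingT K n := by
  simpa [size] using augMonoT_mem_gradingT (K := K) {n}

theorem isInternal_gradingT : DirectSum.IsInternal (gradingT K) := by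
  rw [DirectSum.isInternal_submodule_iff_iSupIndep_and_iSup_eq_top]
  constructor
  · exact iSupIndep_grading.map_orderIso (Submodule.orderIsoMapComap (toT K))
  · rw [eq_top_iff, ← (augMonoBasisT K).span_eq, Submodule.span_le]
    rintro _ ⟨lam, rfl⟩
    rw [augMonoBasisT_apply]
    exact Submodule.mem_iSup_of_mem _ (augMonoT_mem_gradingT lam)

theorem one_mem_gradingT : (1 : SymT K) ∈ gradingT K 0 := augMonoT_mem_gradingT 0

theorem mul_mem_gradingT {m n : ℕ} {f g : SymT K} (hf : f ∈ gradingT K m) (hg : g ∈ gradingT K n) :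
    f * g ∈ gradingT K (m + n) := by
  rw [mem_gradingT_iff] at *
  rw [map_mul]
  exact mul_mem_grading hf hg

/-- The homogeneous elements of degree `n` of `Λ̃ ⊗ Λ̃`. -/
def gradingTensor (K : Type*) [Field K] [CharZero K] (n : ℕ) : Submodule K (SymT K ⊗[K] SymT K) :=
  ⨆ p ∈ Finset.HasAntidiagonal.antidiagonal n,
    LinearMap.range (TensorProduct.map (gradingT K p.1).subtype (gradingT K p.2).subtype)

theorem tmul_mem_gradingTensor {k l : ℕ} {f g : SymT K} (hf : f ∈ gradingT K k)
    (hg : g ∈ gradingT K l) : f ⊗ₜ g ∈ gradingTensor K (k + l) := by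
  have h : (k, l) ∈ Finset.HasAntidiagonal.antidiagonal (k + l) := by
    rw [Finset.HasAntidiagonal.mem_antidiagonal]
  refine Submodule.mem_iSup_of_mem (k, l) (Submodule.mem_iSup_of_mem h ?_)
  exact ⟨⟨f, hf⟩ ⊗ₜ ⟨g, hg⟩, rfl⟩

/-- Since `m̃_k` is primitive, the product raises by `k` the degree of one tensor factor at a time.
-/
theorem comulT_mul_mem_gradingTensor (k : ℕ+) {n : ℕ} {t : SymT K ⊗[K] SymT K}
    (ht : t ∈ gradingTensor K n) :
    comulT K (augMonoT K {k}) * t ∈ gradingTensor K (k + n) := by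
  suffices h : gradingTensor K n ≤ (gradingTensor K (k + n)).comap
      (LinearMap.mulLeft K (comulT K (augMonoT K {k}))) from h ht
  refine iSup₂_le fun p hp => ?_
  rw [Finset.HasAntidiagonal.mem_antidiagonal] at hp
  rintro _ ⟨z, rfl⟩
  rw [Submodule.mem_comap, LinearMap.mulLeft_apply]
  have hk := augMonoT_singleton_mem_gradingT (K := K) k
  induction z using TensorProduct.induction_on with
  | zero => simp
  | add x y hx hy =>
    rw [map_add, mul_add]
    exact add_mem hx hy
  | tmul x y =>
    rw [TensorProduct.map_tmul, comulT_augMonoT, add_mul, Algebra.TensorProduct.tmul_mul_tmul,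
      Algebra.TensorProduct.tmul_mul_tmul, one_mul, one_mul]
    refine add_mem ?_ ?_
    · rw [← hp, ← add_assoc]
      exact tmul_mem_gradingTensor (mul_mem_gradingT hk x.2) y.2
    · rw [← hp, add_left_comm]
      exact tmul_mem_gradingTensor x.2 (mul_mem_gradingT hk y.2)

theorem comulT_mem_gradingTensor {n : ℕ} {f : SymT K} (hf : f ∈ gradingT K n) :
    comulT K f ∈ gradingTensor K n := by
  suffices h : gradingT K n ≤ (gradingTensor K n).comap (comulT K).toLinearMap from h hf
  clear hf
  rw [gradingT_eq_span, Submodule.span_le]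
  rintro _ ⟨lam, rfl, rfl⟩
  rw [SetLike.mem_coe, Submodule.mem_comap, AlgHom.toLinearMap_apply]
  induction lam using Multiset.induction with
  | empty =>
    have h0 : size 0 = 0 + 0 := rfl
    rw [augMonoT_zero, map_one (comulT K), Algebra.TensorProduct.one_def, h0]
    exact tmul_mem_gradingTensor one_mem_gradingT one_mem_gradingT
  | cons n lam ih =>
    rw [augMonoT_cons, map_mul, size_cons]
    exact comulT_mul_mem_gradingTensor n ih

/-! ### The Hopf algebra `Λ̃` -/

theorem counit_augMonoT_cons (n : ℕ+) (lam : Ptn) :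
    Coalgebra.counit (R := K) (augMonoT K (n ::ₘ lam)) = 0 := by
  have h : Coalgebra.counit (R := K) (augMonoT K (n ::ₘ lam)) =
      cf 0 (augMono K (n ::ₘ lam)) := by
    rw [cf, LinearMap.comp_apply, MvPowerSeries.coeff_zero_eq_constantCoeff_apply]
    rfl
  rw [h, cf_augMono, if_neg]
  rw [(typ_eq_zero 0).2 rfl]
  exact Multiset.zero_ne_cons

theorem counit_augMonoT_zero : Coalgebra.counit (R := K) (1 : SymT K) = 1 := by
  have : (1 : SymT K) = toT K 1 := by rw [← augMono_zero]; rfl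
  rw [this, counit_toT, Bialgebra.counit_one]

/-! ### Compatibility of the isomorphism with counit, coproduct and antipode. -/

theorem counit_powToAug (f : Sym K) :
    Coalgebra.counit (R := K) (powToAug K f) = Coalgebra.counit (R := K) f := by
  induction f using (powSumBasis K).induction_on with
  | zero => simp
  | add f g hf hg => simp only [map_add, hf, hg]
  | smul c f hf => simp only [map_smul, hf]
  | basis lam =>
    rw [powSumBasis_apply, powToAug_powSumPtn]
    induction lam using Multiset.induction with
    | empty =>
      rw [augMonoT_zero, counit_augMonoT_zero, powSumPtn, Multiset.map_zero, Multiset.prod_zero,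
        Bialgebra.counit_one]
    | cons n lam =>
      have h : Coalgebra.counit (R := K) (powSum K n) = 0 := counitHom_powSum n
      rw [counit_augMonoT_cons, powSumPtn_cons, Bialgebra.counit_mul, h, zero_mul]

/-- Once `Δ = δ` on `Λ̃`, both sides are algebra homomorphisms on `Λ`, so comparing them on the
`p_n` suffices. -/
theorem comul_powToAug (f : Sym K) :
    TensorProduct.map (powToAug K).toLinearMap (powToAug K).toLinearMap
      (Coalgebra.comul (R := K) f) = Coalgebra.comul (R := K) (powToAug K f) := by
  rw [comul_eq_comulT]
  have h : (Algebra.TensorProduct.map (powToAug K : Sym K →ₐ[K] SymT K)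
      (powToAug K : Sym K →ₐ[K] SymT K)).comp (comulHom K) =
      (comulT K).comp (powToAug K : Sym K →ₐ[K] SymT K) := by
    refine hom_ext fun n => ?_
    have hn : (powToAug K : Sym K →ₐ[K] SymT K) (powSum K n) = augMonoT K {n} := powToAug_powSum n
    rw [AlgHom.comp_apply, AlgHom.comp_apply, comulHom_powSum, hn, comulT_augMonoT, map_add,
      Algebra.TensorProduct.map_tmul, Algebra.TensorProduct.map_tmul, hn, map_one]
  exact DFunLike.congr_fun h f

/-- The isomorphism of bialgebras `Λ → Λ̃` with `p_λ ↦ m̃_λ`. -/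
def powToAugBialg (K : Type*) [Field K] [CharZero K] : Sym K ≃ₐc[K] SymT K :=
  { powToAug K with
    map_smul' := map_smul (powToAug K)
    counit_comp := LinearMap.ext counit_powToAug
    map_comp_comul := LinearMap.ext comul_powToAug }

/-- The antipode of `Λ̃`: the algebra homomorphism with `m̃_n ↦ -m̃_n`. -/
def antipodeT (K : Type*) [Field K] [CharZero K] : SymT K →ₐ[K] SymT K :=
  ((powToAug K : Sym K →ₐ[K] SymT K).comp (antipodeHom K)).comp
    ((powToAug K).symm : SymT K →ₐ[K] Sym K)

theorem antipodeT_powToAug (f : Sym K) :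
    antipodeT K (powToAug K f) = powToAug K (HopfAlgebra.antipode K f) :=
  congrArg (fun g => powToAug K (antipodeHom K g)) ((powToAug K).symm_apply_apply f)

theorem antipodeT_augMonoT (n : ℕ+) : antipodeT K (augMonoT K {n}) = -augMonoT K {n} := by
  rw [← powToAug_powSum, antipodeT_powToAug, antipode_powSum, map_neg]

theorem antipodeT_mem {n : ℕ} {f : SymT K} (hf : f ∈ gradingT K n) :
    antipodeT K f ∈ gradingT K n := by
  suffices h : gradingT K n ≤ (gradingT K n).comap (antipodeT K).toLinearMap from h hf
  clear hf
  nth_rw 1 [gradingT_eq_span]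
  rw [Submodule.span_le]
  rintro _ ⟨lam, rfl, rfl⟩
  rw [SetLike.mem_coe, Submodule.mem_comap, AlgHom.toLinearMap_apply]
  induction lam using Multiset.induction with
  | empty =>
    rw [augMonoT_zero, map_one]
    exact one_mem_gradingT
  | cons n lam ih =>
    rw [augMonoT_cons, map_mul, size_cons, antipodeT_augMonoT]
    exact mul_mem_gradingT (neg_mem (augMonoT_singleton_mem_gradingT n)) ih

theorem mul_antipodeT_rTensor (t : Sym K ⊗[K] Sym K) :
    LinearMap.mul' K (SymT K) ((antipodeT K).toLinearMap.rTensor _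
      (TensorProduct.map (powToAug K).toLinearMap (powToAug K).toLinearMap t)) =
    powToAug K (LinearMap.mul' K (Sym K) ((HopfAlgebra.antipode K).rTensor _ t)) := by
  induction t using TensorProduct.induction_on with
  | zero => simp
  | add t u ht hu => simp only [map_add, ht, hu]
  | tmul f g => simp [antipodeT_powToAug]

theorem mul_antipodeT_lTensor (t : Sym K ⊗[K] Sym K) :
    LinearMap.mul' K (SymT K) ((antipodeT K).toLinearMap.lTensor _
      (TensorProduct.map (powToAug K).toLinearMap (powToAug K).toLinearMap t)) =
    powToAug K (LinearMap.mul' K (Sym K) ((HopfAlgebra.antipode K).lTensor _ t)) := by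
  induction t using TensorProduct.induction_on with
  | zero => simp
  | add t u ht hu => simp only [map_add, ht, hu]
  | tmul f g => simp [antipodeT_powToAug]

theorem counit_eq_zero_of_mem_gradingT {n : ℕ} {f : SymT K} (hf : f ∈ gradingT K n) (hn : n ≠ 0) :
    Coalgebra.counit (R := K) f = 0 := by
  suffices h : gradingT K n ≤ LinearMap.ker (Coalgebra.counit (R := K) (A := SymT K)) from h hf
  rw [gradingT_eq_span, Submodule.span_le]
  rintro _ ⟨lam, rfl, rfl⟩
  rw [SetLike.mem_coe, LinearMap.mem_ker]
  induction lam using Multiset.induction with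
  | empty => exact absurd rfl hn
  | cons n lam => exact counit_augMonoT_cons n lam

/-- Multiplicativity of the coproduct comes from `Δ = δ`; that of the counit and the antipode
identities are transported from `Λ`. -/
theorem isGradedHopfAlgebra_symT :
    IsGradedHopfAlgebra K (antipodeT K).toLinearMap (gradingT K) where
  counit_one := counit_augMonoT_zero
  counit_mul f g := by
    obtain ⟨f, rfl⟩ := (powToAug K).surjective f
    obtain ⟨g, rfl⟩ := (powToAug K).surjective g
    rw [← map_mul, counit_powToAug, counit_powToAug, counit_powToAug, Bialgebra.counit_mul]
  comul_one := by rw [comul_eq_comulT, map_one]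
  comul_mul f g := by simp only [comul_eq_comulT, map_mul]
  mul_antipode_rTensor_comul := by
    ext f
    obtain ⟨f, rfl⟩ := (powToAug K).surjective f
    rw [LinearMap.comp_apply, LinearMap.comp_apply, LinearMap.comp_apply, ← comul_powToAug,
      mul_antipodeT_rTensor, HopfAlgebra.mul_antipode_rTensor_comul_apply, AlgEquiv.commutes,
      counit_powToAug, Algebra.linearMap_apply]
  mul_antipode_lTensor_comul := by
    ext f
    obtain ⟨f, rfl⟩ := (powToAug K).surjective f
    rw [LinearMap.comp_apply, LinearMap.comp_apply, LinearMap.comp_apply, ← comul_powToAug,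
      mul_antipodeT_lTensor, HopfAlgebra.mul_antipode_lTensor_comul_apply, AlgEquiv.commutes,
      counit_powToAug, Algebra.linearMap_apply]
  isInternal := isInternal_gradingT
  one_mem := one_mem_gradingT
  mul_mem := mul_mem_gradingT
  comul_mem {n f} hf := by
    rw [comul_eq_comulT]
    exact comulT_mem_gradingTensor hf
  counit_eq_zero := counit_eq_zero_of_mem_gradingT
  antipode_mem := antipodeT_mem

end SymmFun

end

open SymmFun in
theorem proposition1p2 (K : Type*) [Field K] [CharZero K] :
    ∃ S : SymT K →ₐ[K] SymT K,
      (∀ n : ℕ+, S (augMonoT K {n}) = -augMonoT K {n}) ∧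
      IsGradedHopfAlgebra K S.toLinearMap (gradingT K) ∧
      ∃ φ : Sym K ≃ₐc[K] SymT K,
        (∀ lam : Ptn, φ (powSumPtn K lam) = augMonoT K lam) ∧
        (∀ f : Sym K, φ (HopfAlgebra.antipode K f) = S (φ f)) ∧
        ∀ n : ℕ, (grading K n).map (φ : Sym K →ₗ[K] SymT K) = gradingT K n :=
  ⟨antipodeT K, antipodeT_augMonoT, isGradedHopfAlgebra_symT, powToAugBialg K, powToAug_powSumPtn,
    fun f => (antipodeT_powToAug f).symm, map_powToAug_grading⟩
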